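/- Let $0<\alpha<1$. For a measurable function $\psi:[0,1]\to[0,1]$ let $V_\psi$ be the bounded operator on the complex Hilbert space $L^2(0,1)$ given by $(V_\psi f)(x)=\int_0^{\psi(x)}f(t)\,dt$. Put $\phi(x)=1-(1-x)^{1/\alpha}$ for $x\in[0,1]$. Then $(Uf)(x)=f(1-x)$ defines a unitary operator $U$ on $L^2(0,1)$ and $$V_{x^\alpha}^*=U^{-1}V_\phi U ,$$ so that $V_{x^\alpha}^*$ and $V_\phi$ are unitarily equivalent; and the point spectrum (the set of eigenvalues) of $V_\phi$ is $$\sigma_p(V_\phi)=\{(1-\alpha)\alpha^{n-1}: n=1,2,3,\dots\}.$$ -/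

import Mathlib

open MeasureTheory Set

noncomputable section

/-- Lebesgue measure on the interval `(0,1)`. -/
abbrev muI : Measure ℝ := volume.restrict (Ioo (0 : ℝ) 1)

/-- The complex Hilbert space `L²(0,1)`. -/
abbrev L2I : Type := Lp ℂ 2 muI

/-- The function `x ↦ ∫_0^{φ(x)} f(t) dt`. -/
def volterraFun (φ : ℝ → ℝ) (f : ℝ → ℂ) (x : ℝ) : ℂ := ∫ t in (0 : ℝ)..(φ x), f t

theorem muI_univ : muI univ = 1 := by
  simp [muI]

instance : IsProbabilityMeasure muI := ⟨muI_univ⟩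

theorem restrict_Ioc_eq_muI : volume.restrict (Ioc (0 : ℝ) 1) = muI :=
  (Measure.restrict_congr_set Ioo_ae_eq_Ioc).symm

theorem L2I_integrable (f : L2I) : Integrable (f : ℝ → ℂ) muI :=
  (Lp.memLp f).integrable (by norm_num)

theorem L2I_integrableOn (f : L2I) : IntegrableOn (f : ℝ → ℂ) (Ioc 0 1) volume := by
  rw [IntegrableOn, restrict_Ioc_eq_muI]
  exact L2I_integrable f

theorem L2I_intervalIntegrable (f : L2I) {y : ℝ} (hy : y ∈ Icc (0 : ℝ) 1) :
    IntervalIntegrable (f : ℝ → ℂ) volume 0 y :=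
  (intervalIntegrable_iff_integrableOn_Ioc_of_le hy.1).2
    ((L2I_integrableOn f).mono_set (Ioc_subset_Ioc_right hy.2))

theorem volterraFun_congr {φ : ℝ → ℝ} (hφ : MapsTo φ (Icc 0 1) (Icc 0 1)) {f g : ℝ → ℂ}
    (h : f =ᵐ[muI] g) {x : ℝ} (hx : x ∈ Icc (0 : ℝ) 1) :
    volterraFun φ f x = volterraFun φ g x := by
  have hy := hφ hx
  unfold volterraFun
  rw [intervalIntegral.integral_of_le hy.1, intervalIntegral.integral_of_le hy.1]
  refine integral_congr_ae ?_
  rw [← restrict_Ioc_eq_muI] at h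
  exact ae_mono (Measure.restrict_mono (Ioc_subset_Ioc_right hy.2) le_rfl) h

theorem L2I_integral_norm_le (f : L2I) : ∫ t, ‖f t‖ ∂muI ≤ ‖f‖ := by
  rw [integral_norm_eq_lintegral_enorm (Lp.aestronglyMeasurable f), Lp.norm_def,
    ← eLpNorm_one_eq_lintegral_enorm]
  exact ENNReal.toReal_mono (Lp.eLpNorm_ne_top f)
    (eLpNorm_le_eLpNorm_of_exponent_le (by norm_num) (Lp.aestronglyMeasurable f))

theorem norm_volterraFun_le {φ : ℝ → ℝ} (hφ : MapsTo φ (Icc 0 1) (Icc 0 1)) (f : L2I)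
    {x : ℝ} (hx : x ∈ Icc (0 : ℝ) 1) : ‖volterraFun φ f x‖ ≤ ‖f‖ := by
  have hy := hφ hx
  refine le_trans ?_ (L2I_integral_norm_le f)
  unfold volterraFun
  rw [intervalIntegral.integral_of_le hy.1]
  refine (norm_integral_le_integral_norm _).trans ?_
  have h : ∫ t in Ioc 0 (φ x), ‖f t‖ ≤ ∫ t in Ioc 0 1, ‖f t‖ :=
    setIntegral_mono_set (L2I_integrableOn f).norm
      (Filter.Eventually.of_forall fun _ => norm_nonneg _)
      (Ioc_subset_Ioc_right hy.2).eventuallyLE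
  exact h.trans_eq (congrArg (fun m : Measure ℝ => ∫ t, ‖(f : ℝ → ℂ) t‖ ∂m) restrict_Ioc_eq_muI)

theorem ae_mem_Icc_muI : ∀ᵐ x ∂muI, x ∈ Icc (0 : ℝ) 1 :=
  (ae_restrict_mem measurableSet_Ioo).mono fun _ hx => Ioo_subset_Icc_self hx

theorem aestronglyMeasurable_volterraFun {φ : ℝ → ℝ} (hm : Measurable φ)
    (hφ : MapsTo φ (Icc 0 1) (Icc 0 1)) (f : L2I) :
    AEStronglyMeasurable (volterraFun φ f) muI := by
  set g : ℝ → ℂ := (Ioc (0 : ℝ) 1).indicator f with hg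
  have hgi : Integrable g volume := (L2I_integrableOn f).integrable_indicator measurableSet_Ioc
  have hc : Continuous fun y : ℝ => ∫ t in (0 : ℝ)..y, g t :=
    intervalIntegral.continuous_primitive (fun a b => hgi.intervalIntegrable) 0
  have hfg : (f : ℝ → ℂ) =ᵐ[muI] g := by
    filter_upwards [ae_restrict_mem (μ := volume) (measurableSet_Ioo (a := (0 : ℝ)) (b := 1))]
      with x hx
    rw [hg, indicator_of_mem (Ioo_subset_Ioc_self hx)]
  have hs : StronglyMeasurable (volterraFun φ g) := hc.stronglyMeasurable.comp_measurable hm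
  refine hs.aestronglyMeasurable.congr ?_
  filter_upwards [ae_mem_Icc_muI] with x hx
  exact (volterraFun_congr hφ hfg hx).symm

theorem memLp_volterraFun {φ : ℝ → ℝ} (hm : Measurable φ)
    (hφ : MapsTo φ (Icc 0 1) (Icc 0 1)) (f : L2I) : MemLp (volterraFun φ f) 2 muI :=
  MemLp.of_bound (aestronglyMeasurable_volterraFun hm hφ f) ‖f‖
    (ae_mem_Icc_muI.mono fun _ hx => norm_volterraFun_le hφ f hx)

/-- For a measurable `φ : [0,1] → [0,1]`, the bounded operator `V_φ` on `L²(0,1)`,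
`(V_φ f)(x) = ∫_0^{φ(x)} f(t) dt`. -/
def volterraOp (φ : ℝ → ℝ) (hm : Measurable φ) (hφ : MapsTo φ (Icc 0 1) (Icc 0 1)) :
    L2I →L[ℂ] L2I :=
  LinearMap.mkContinuous
    { toFun := fun f => (memLp_volterraFun hm hφ f).toLp (volterraFun φ f)
      map_add' := by
        intro f g
        rw [← MemLp.toLp_add, MemLp.toLp_eq_toLp_iff]
        filter_upwards [ae_mem_Icc_muI] with x hx
        rw [volterraFun_congr hφ (Lp.coeFn_add f g) hx]
        exact intervalIntegral.integral_add (L2I_intervalIntegrable f (hφ hx))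
          (L2I_intervalIntegrable g (hφ hx))
      map_smul' := by
        intro c f
        rw [RingHom.id_apply, ← MemLp.toLp_const_smul, MemLp.toLp_eq_toLp_iff]
        filter_upwards [ae_mem_Icc_muI] with x hx
        rw [volterraFun_congr hφ (Lp.coeFn_smul c f) hx]
        exact intervalIntegral.integral_smul c _ }
    1 (by
      intro f
      have h := Lp.norm_le_of_ae_bound (f := (memLp_volterraFun hm hφ f).toLp (volterraFun φ f))
        (norm_nonneg f) (by
          filter_upwards [ae_mem_Icc_muI, (memLp_volterraFun hm hφ f).coeFn_toLp] with x hx h2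
          rw [h2]
          exact norm_volterraFun_le hφ f hx)
      simpa [measureUnivNNReal] using h)

theorem volterraOp_coeFn (φ : ℝ → ℝ) (hm : Measurable φ) (hφ : MapsTo φ (Icc 0 1) (Icc 0 1))
    (f : L2I) : volterraOp φ hm hφ f =ᵐ[muI] fun x => ∫ t in (0 : ℝ)..(φ x), f t :=
  (memLp_volterraFun hm hφ f).coeFn_toLp

theorem measurable_powFun (α : ℝ) : Measurable fun x : ℝ => x ^ α := by
  fun_prop

theorem mapsTo_powFun {α : ℝ} (h0 : 0 < α) :
    MapsTo (fun x : ℝ => x ^ α) (Icc 0 1) (Icc 0 1) := fun _ hx =>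
  ⟨Real.rpow_nonneg hx.1 _, Real.rpow_le_one hx.1 hx.2 h0.le⟩

theorem measurable_reflPowFun (α : ℝ) : Measurable fun x : ℝ => 1 - (1 - x) ^ (1 / α) := by
  fun_prop

theorem mapsTo_reflPowFun {α : ℝ} (h0 : 0 < α) :
    MapsTo (fun x : ℝ => 1 - (1 - x) ^ (1 / α)) (Icc 0 1) (Icc 0 1) := by
  intro x hx
  have h := mapsTo_powFun (one_div_pos.2 h0) (x := 1 - x)
    ⟨by linarith [hx.2], by linarith [hx.1]⟩
  simp only [mem_Icc] at h ⊢
  constructor <;> linarith [h.1, h.2]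

/-- The point spectrum `σ_p(T)`: the set of eigenvalues of the bounded operator `T`. -/
def pointSpectrum (T : L2I →L[ℂ] L2I) : Set ℂ :=
  {μ : ℂ | Module.End.HasEigenvalue (T : L2I →ₗ[ℂ] L2I) μ}

end

/-! Put β = 1/α and w = 1/μ. Conjugating V_φ by the reflection gives f ↦ ∫_{x^β}^1 f, and Fubini
identifies this with the adjoint of V_{x^α} (`reflConj_eq_adjoint`). It is injective, so μ = 0 is no
eigenvalue. For μ ≠ 0 the eigenvalue equation g(x) = w ∫_{x^β}^1 g amounts to g(x) = C - w ∫_0^{x^β}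
g together with C = w ∫_0^1 g, that is, g(1) = 0.

Picard iteration solves the initial value equation by C times the explicit series `qSeries`, and a
Volterra estimate shows that nothing else does (`eq_smul_qSeries`). So μ is an eigenvalue exactly
when that series vanishes at x = 1, where it is a q-exponential E(w). The relation E(w) = (1 -
(1-α)w) E(αw) with E(0) = 1 and continuity means in effect E(w) = ∏ (1 - (1-α)αⁿw), so the zeros are
the numbers w = 1/((1-α)αⁿ). -/

/-! ### The q-exponential and its zeros -/

/-- The geometric sum `1 + β + ⋯ + β ^ k`. -/
noncomputable def geomSum (β : ℝ) (k : ℕ) : ℝ := ∑ i ∈ Finset.range (k + 1), β ^ i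

/-- The coefficients `∏_{j < k} 1 / (1 + β + ⋯ + β ^ j)` of the `q`-exponential series. -/
noncomputable def qCoeff (β : ℝ) (k : ℕ) : ℝ := ∏ j ∈ Finset.range k, (geomSum β j)⁻¹

theorem geomSum_zero (β : ℝ) : geomSum β 0 = 1 := by simp [geomSum]

theorem geomSum_succ (β : ℝ) (k : ℕ) : geomSum β (k + 1) = β * geomSum β k + 1 := by
  unfold geomSum
  rw [Finset.sum_range_succ', Finset.mul_sum]
  simp [pow_succ, mul_comm]

theorem natCast_succ_le_geomSum {β : ℝ} (hβ : 1 ≤ β) (k : ℕ) : (k + 1 : ℝ) ≤ geomSum β k := by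
  induction k with
  | zero => simp [geomSum_zero]
  | succ k ih =>
    rw [geomSum_succ]
    push_cast
    nlinarith

theorem one_le_geomSum {β : ℝ} (hβ : 1 ≤ β) (k : ℕ) : 1 ≤ geomSum β k :=
  le_trans (by linarith [(Nat.cast_nonneg k : (0 : ℝ) ≤ k)]) (natCast_succ_le_geomSum hβ k)

theorem geomSum_pos {β : ℝ} (hβ : 1 ≤ β) (k : ℕ) : 0 < geomSum β k :=
  one_pos.trans_le (one_le_geomSum hβ k)

theorem qCoeff_zero (β : ℝ) : qCoeff β 0 = 1 := by simp [qCoeff]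

theorem qCoeff_succ (β : ℝ) (k : ℕ) : qCoeff β (k + 1) = qCoeff β k * (geomSum β k)⁻¹ := by
  rw [qCoeff, Finset.prod_range_succ, qCoeff]

theorem qCoeff_nonneg {β : ℝ} (hβ : 1 ≤ β) (k : ℕ) : 0 ≤ qCoeff β k :=
  Finset.prod_nonneg fun j _ => inv_nonneg.2 (geomSum_pos hβ j).le

/-- Since β ≥ 1, the j-th factor is at most 1/(j+1); the series is therefore dominated by the
exponential series and converges for every w. -/
theorem qCoeff_le {β : ℝ} (hβ : 1 ≤ β) (k : ℕ) : qCoeff β k ≤ (k.factorial : ℝ)⁻¹ := by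
  induction k with
  | zero => simp [qCoeff_zero]
  | succ k ih =>
    rw [qCoeff_succ, Nat.factorial_succ, Nat.cast_mul, mul_inv, mul_comm]
    refine mul_le_mul ?_ ih (qCoeff_nonneg hβ k) (by positivity)
    push_cast
    exact inv_anti₀ (by positivity) (natCast_succ_le_geomSum hβ k)

/-- The `k`-th term of the `q`-exponential series at the point `-w`. -/
noncomputable def qTerm (β : ℝ) (w : ℂ) (k : ℕ) : ℂ := (qCoeff β k : ℂ) * (-w) ^ k

/-- The `q`-exponential series `∑ c_k (-w)^k`. -/
noncomputable def qExp (β : ℝ) (w : ℂ) : ℂ := ∑' k, qTerm β w k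

theorem norm_qTerm_le {β : ℝ} (hβ : 1 ≤ β) (w : ℂ) (k : ℕ) :
    ‖qTerm β w k‖ ≤ ‖w‖ ^ k / (k.factorial : ℝ) := by
  rw [qTerm, norm_mul, norm_pow, norm_neg, Complex.norm_real, Real.norm_of_nonneg
    (qCoeff_nonneg hβ k), mul_comm, div_eq_mul_inv]
  exact mul_le_mul_of_nonneg_left (qCoeff_le hβ k) (by positivity)

theorem summable_norm_qTerm {β : ℝ} (hβ : 1 ≤ β) (w : ℂ) : Summable fun k => ‖qTerm β w k‖ :=
  Summable.of_nonneg_of_le (fun _ => norm_nonneg _) (norm_qTerm_le hβ w)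
    (Real.summable_pow_div_factorial ‖w‖)

theorem qTerm_zero (β : ℝ) (w : ℂ) : qTerm β w 0 = 1 := by simp [qTerm, qCoeff_zero]

theorem qTerm_succ (β : ℝ) (w : ℂ) (k : ℕ) :
    qTerm β w (k + 1) = -w * (qTerm β w k * ((geomSum β k)⁻¹ : ℝ)) := by
  simp only [qTerm, qCoeff_succ, pow_succ]
  push_cast
  ring

/-- The functional equation of the `q`-exponential series. -/
theorem qExp_eq {α : ℝ} (h0 : 0 < α) (h1 : α < 1) (w : ℂ) :
    qExp α⁻¹ w = (1 - w * (1 - α)) * qExp α⁻¹ (α * w) := by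
  have hβ : 1 ≤ α⁻¹ := (one_le_inv₀ h0).2 h1.le
  have hs := fun w => (summable_norm_qTerm hβ w).of_norm
  -- The functional equation holds coefficient by coefficient; it reduces to the geometric sum `hg`
  -- in powers of α.
  have key : ∀ k, qTerm α⁻¹ w (k + 1) =
      qTerm α⁻¹ (α * w) (k + 1) + -(w * (1 - α)) * qTerm α⁻¹ (α * w) k := by
    intro k
    have hg : geomSum α⁻¹ k * (1 - α) * α ^ k = 1 - α ^ (k + 1) := by
      induction k with
      | zero => simp [geomSum_zero]
      | succ k ih =>
        rw [geomSum_succ]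
        calc (α⁻¹ * geomSum α⁻¹ k + 1) * (1 - α) * α ^ (k + 1)
            = (α⁻¹ * α) * (geomSum α⁻¹ k * (1 - α) * α ^ k) + (1 - α) * α ^ (k + 1) := by ring
          _ = _ := by rw [ih, inv_mul_cancel₀ h0.ne']; ring
    have hpos := (geomSum_pos hβ k).ne'
    have hgC : (geomSum α⁻¹ k : ℂ) * (1 - α) * (α : ℂ) ^ k = 1 - (α : ℂ) ^ (k + 1) := by
      exact_mod_cast hg
    have hposC : (geomSum α⁻¹ k : ℂ) ≠ 0 := by exact_mod_cast hpos
    simp only [qTerm, qCoeff_succ]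
    push_cast
    rw [show (-((α : ℂ) * w)) = α * (-w) by ring, mul_pow, mul_pow]
    generalize qCoeff α⁻¹ k = c
    generalize geomSum α⁻¹ k = u at hgC hposC
    field_simp
    linear_combination (-((c : ℂ) * (-w) ^ (k + 1))) * hgC
  unfold qExp
  rw [(hs w).tsum_eq_zero_add, qTerm_zero, tsum_congr key,
    ((summable_nat_add_iff 1).2 (hs (α * w))).tsum_add ((hs (α * w)).mul_left _), tsum_mul_left]
  have := (hs (α * w)).tsum_eq_zero_add
  rw [qTerm_zero] at this
  linear_combination -this

theorem qExp_zero (β : ℝ) : qExp β 0 = 1 := by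
  unfold qExp
  rw [tsum_eq_single 0, qTerm_zero]
  intro k hk
  simp [qTerm, hk]

theorem continuousOn_qExp {β : ℝ} (hβ : 1 ≤ β) (R : ℝ) :
    ContinuousOn (qExp β) (Metric.closedBall 0 R) := by
  have hu : Summable fun k : ℕ => R ^ k / (k.factorial : ℝ) := Real.summable_pow_div_factorial R
  refine continuousOn_tsum (f := fun k w => qTerm β w k) ?_ hu ?_
  · intro k
    have : Continuous fun w : ℂ => (qCoeff β k : ℂ) * (-w) ^ k := by fun_prop
    exact this.continuousOn
  · intro k w hw
    have hR : ‖w‖ ≤ R := mem_closedBall_zero_iff.1 hw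
    exact (norm_qTerm_le hβ w k).trans
      (div_le_div_of_nonneg_right (pow_le_pow_left₀ (norm_nonneg w) hR k) (Nat.cast_nonneg _))

theorem continuous_qExp {β : ℝ} (hβ : 1 ≤ β) : Continuous (qExp β) := by
  rw [continuous_iff_continuousAt]
  intro w
  refine (continuousOn_qExp hβ (‖w‖ + 1)).continuousAt ?_
  refine Filter.mem_of_superset (Metric.isOpen_ball.mem_nhds ?_) Metric.ball_subset_closedBall
  simp

/-- If no factor 1 - w(1-α)αⁿ vanishes, a zero at w forces zeros at all αⁿw, which tend to 0, where
the value is 1. Conversely, a vanishing factor gives a zero at αⁿw, which the functional equation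
carries back to w. -/
theorem qExp_eq_zero_iff {α : ℝ} (h0 : 0 < α) (h1 : α < 1) (w : ℂ) :
    qExp α⁻¹ w = 0 ↔ ∃ n : ℕ, w * ((1 - α) * α ^ n) = 1 := by
  have hβ : 1 ≤ α⁻¹ := (one_le_inv₀ h0).2 h1.le
  have hstep : ∀ n : ℕ, qExp α⁻¹ ((α : ℂ) ^ n * w) =
      (1 - w * ((1 - α) * α ^ n)) * qExp α⁻¹ ((α : ℂ) ^ (n + 1) * w) := by
    intro n
    rw [qExp_eq h0 h1, ← mul_assoc (α : ℂ), ← pow_succ']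
    ring
  constructor
  · intro h
    by_contra! hne
    have hz : ∀ n : ℕ, qExp α⁻¹ ((α : ℂ) ^ n * w) = 0 := by
      intro n
      induction n with
      | zero => simpa using h
      | succ n ih =>
        rw [hstep] at ih
        exact (mul_eq_zero.1 ih).resolve_left fun h' => hne n (sub_eq_zero.1 h').symm
    have hlim : Filter.Tendsto (fun n : ℕ => qExp α⁻¹ ((α : ℂ) ^ n * w)) Filter.atTop
        (nhds (qExp α⁻¹ (0 * w))) := by
      refine ((continuous_qExp hβ).tendsto _).comp (Filter.Tendsto.mul_const w ?_)
      refine tendsto_pow_atTop_nhds_zero_of_norm_lt_one ?_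
      rwa [Complex.norm_real, Real.norm_of_nonneg h0.le]
    simp only [hz, zero_mul, qExp_zero] at hlim
    exact zero_ne_one (tendsto_nhds_unique tendsto_const_nhds hlim)
  · rintro ⟨n, hn⟩
    have hz : ∀ m ≤ n, qExp α⁻¹ ((α : ℂ) ^ (n - m) * w) = 0 := by
      intro m
      induction m with
      | zero => intro _; rw [Nat.sub_zero, hstep, hn, sub_self, zero_mul]
      | succ m ih =>
        intro hm
        rw [hstep, show n - (m + 1) + 1 = n - m by omega, ih (by omega), mul_zero]
    simpa using hz n le_rfl

/-! ### Solving the integral equation by a series -/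

/-- The series `∑ c_k (-w)^k x^{e_k}` with exponents `e_k = β + ⋯ + β ^ k`. -/
noncomputable def qSeries (β : ℝ) (w : ℂ) (x : ℝ) : ℂ :=
  ∑' k, qTerm β w k * ((x ^ (geomSum β k - 1) : ℝ) : ℂ)

theorem qSeries_one (β : ℝ) (w : ℂ) : qSeries β w 1 = qExp β w := by
  simp [qSeries, qExp]

theorem norm_qSeries_term_le {β : ℝ} (hβ : 1 ≤ β) (w : ℂ) (k : ℕ) {x : ℝ}
    (hx : x ∈ Icc (0 : ℝ) 1) :
    ‖qTerm β w k * ((x ^ (geomSum β k - 1) : ℝ) : ℂ)‖ ≤ ‖qTerm β w k‖ := by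
  rw [norm_mul, Complex.norm_real, Real.norm_of_nonneg (Real.rpow_nonneg hx.1 _)]
  exact mul_le_of_le_one_right (norm_nonneg _)
    (Real.rpow_le_one hx.1 hx.2 (sub_nonneg.2 (one_le_geomSum hβ k)))

theorem continuous_qSeries_term {β : ℝ} (hβ : 1 ≤ β) (w : ℂ) (k : ℕ) :
    Continuous fun x : ℝ => qTerm β w k * ((x ^ (geomSum β k - 1) : ℝ) : ℂ) :=
  continuous_const.mul (Complex.continuous_ofReal.comp
    (Real.continuous_rpow_const (sub_nonneg.2 (one_le_geomSum hβ k))))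

theorem continuousOn_qSeries {β : ℝ} (hβ : 1 ≤ β) (w : ℂ) :
    ContinuousOn (qSeries β w) (Icc 0 1) :=
  continuousOn_tsum (fun k => (continuous_qSeries_term hβ w k).continuousOn)
    (summable_norm_qTerm hβ w) fun k _ hx => norm_qSeries_term_le hβ w k hx

theorem integral_qSeries_term {β : ℝ} (hβ : 1 ≤ β) (w : ℂ) (k : ℕ) (y : ℝ) :
    ∫ x in (0 : ℝ)..y, qTerm β w k * ((x ^ (geomSum β k - 1) : ℝ) : ℂ) =
      qTerm β w k * ((y ^ geomSum β k * (geomSum β k)⁻¹ : ℝ) : ℂ) := by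
  have h := one_le_geomSum hβ k
  rw [intervalIntegral.integral_const_mul, intervalIntegral.integral_ofReal,
    integral_rpow (Or.inl (by linarith)), sub_add_cancel, Real.zero_rpow (by linarith), sub_zero,
    div_eq_mul_inv]

/-- The series solves `g(x) = 1 - w ∫_0^{x^β} g`. -/
theorem qSeries_eq {β : ℝ} (hβ : 1 ≤ β) (w : ℂ) {x : ℝ} (hx : x ∈ Icc (0 : ℝ) 1) :
    qSeries β w x = 1 - w * ∫ t in (0 : ℝ)..(x ^ β), qSeries β w t := by
  have hy : x ^ β ∈ Icc (0 : ℝ) 1 := mapsTo_powFun (by linarith) hx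
  have hI : HasSum (fun k => ∫ t in (0 : ℝ)..(x ^ β),
      qTerm β w k * ((t ^ (geomSum β k - 1) : ℝ) : ℂ)) (∫ t in (0 : ℝ)..(x ^ β), qSeries β w t) := by
    have hmem : ∀ t, t ∈ uIoc 0 (x ^ β) → t ∈ Icc (0 : ℝ) 1 := by
      intro t ht
      rw [uIoc_of_le hy.1] at ht
      exact ⟨ht.1.le, ht.2.trans hy.2⟩
    refine intervalIntegral.hasSum_integral_of_dominated_convergence
      (fun k _ => ‖qTerm β w k‖) (fun k => (continuous_qSeries_term hβ w k).aestronglyMeasurable)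
      (fun k => Filter.Eventually.of_forall fun t ht => norm_qSeries_term_le hβ w k (hmem t ht))
      (Filter.Eventually.of_forall fun t _ => summable_norm_qTerm hβ w)
      intervalIntegrable_const
      (Filter.Eventually.of_forall fun t ht => ?_)
    exact (Summable.of_norm_bounded (summable_norm_qTerm hβ w)
      fun k => norm_qSeries_term_le hβ w k (hmem t ht)).hasSum
  have hs : Summable fun k => qTerm β w k * ((x ^ (geomSum β k - 1) : ℝ) : ℂ) :=
    Summable.of_norm_bounded (summable_norm_qTerm hβ w) fun k => norm_qSeries_term_le hβ w k hx
  rw [← hI.tsum_eq, ← tsum_mul_left, qSeries, hs.tsum_eq_zero_add, qTerm_zero, geomSum_zero,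
    sub_self, Real.rpow_zero, Complex.ofReal_one, mul_one, sub_eq_add_neg, ← tsum_neg]
  congr 1
  refine tsum_congr fun k => ?_
  -- Integrating the k-th term up to x^β gives the exponent β(1 + e_k) = e_{k+1}, so the integral
  -- shifts the series by one index.
  rw [integral_qSeries_term hβ, qTerm_succ, geomSum_succ, add_sub_cancel_right,
    Real.rpow_mul hx.1]
  push_cast
  ring

/-! ### Uniqueness of bounded solutions -/

/-- A Volterra-type uniqueness principle: the only bounded solution of `d(x) = -w ∫_0^{x^β} d`
is zero. -/
theorem eq_zero_of_eq_integral {β : ℝ} (hβ : 1 ≤ β) (w : ℂ) {d : ℝ → ℂ} {M : ℝ}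
    (hM : ∀ x ∈ Icc (0 : ℝ) 1, ‖d x‖ ≤ M)
    (hd : ∀ x ∈ Icc (0 : ℝ) 1, d x = -w * ∫ t in (0 : ℝ)..(x ^ β), d t) :
    ∀ x ∈ Icc (0 : ℝ) 1, d x = 0 := by
  -- Iterating the equation gives the classical Volterra bound, because x^β ≤ x on [0,1] when β ≥ 1.
  have hb : ∀ n : ℕ, ∀ x ∈ Icc (0 : ℝ) 1, ‖d x‖ ≤ M * (‖w‖ ^ n / (n.factorial : ℝ)) * x ^ n := by
    have hM0 : 0 ≤ M := (norm_nonneg _).trans (hM 0 ⟨le_rfl, zero_le_one⟩)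
    intro n
    induction n with
    | zero => simpa using hM
    | succ n ih =>
      intro x hx
      have hy : x ^ β ∈ Icc (0 : ℝ) 1 := mapsTo_powFun (by linarith) hx
      have hyx : x ^ β ≤ x := by
        simpa using Real.rpow_le_rpow_of_exponent_ge_of_imp hx.1 hx.2 hβ (by intros; linarith)
      rw [hd x hx, norm_mul, norm_neg]
      have hI : ‖∫ t in (0 : ℝ)..(x ^ β), d t‖ ≤
          ∫ t in (0 : ℝ)..(x ^ β), M * (‖w‖ ^ n / (n.factorial : ℝ)) * t ^ n := by
        refine intervalIntegral.norm_integral_le_of_norm_le hy.1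
          (Filter.Eventually.of_forall fun t ht => ih t ⟨ht.1.le, ht.2.trans hy.2⟩) ?_
        exact (by fun_prop : Continuous fun t : ℝ =>
          M * (‖w‖ ^ n / (n.factorial : ℝ)) * t ^ n).intervalIntegrable _ _
      rw [intervalIntegral.integral_const_mul, integral_pow, zero_pow n.succ_ne_zero, sub_zero] at hI
      calc ‖w‖ * ‖∫ t in (0 : ℝ)..(x ^ β), d t‖
          ≤ ‖w‖ * (M * (‖w‖ ^ n / (n.factorial : ℝ)) * ((x ^ β) ^ (n + 1) / (n + 1))) := by gcongr
        _ ≤ ‖w‖ * (M * (‖w‖ ^ n / (n.factorial : ℝ)) * (x ^ (n + 1) / (n + 1))) := by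
            have := hy.1
            gcongr
        _ = _ := by
            rw [Nat.factorial_succ]
            push_cast
            field_simp
            ring
  intro x hx
  have hlim : Filter.Tendsto (fun n : ℕ => M * (‖w‖ ^ n / (n.factorial : ℝ))) Filter.atTop
      (nhds 0) := by
    simpa using (FloorSemiring.tendsto_pow_div_factorial_atTop ‖w‖).const_mul M
  refine norm_le_zero_iff.1 (ge_of_tendsto' hlim fun n => (hb n x hx).trans ?_)
  have hM0 : 0 ≤ M := (norm_nonneg _).trans (hM x hx)
  exact mul_le_of_le_one_right (by positivity) (pow_le_one₀ hx.1 hx.2)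

/-- A bounded solution of `g(x) = w ∫_{x^β}^1 g` is a multiple of the series. -/
theorem eq_smul_qSeries {β : ℝ} (hβ : 1 ≤ β) (w : ℂ) {g : ℝ → ℂ} {M : ℝ}
    (hM : ∀ x ∈ Icc (0 : ℝ) 1, ‖g x‖ ≤ M) (hgi : IntervalIntegrable g volume 0 1)
    (hg : ∀ x ∈ Icc (0 : ℝ) 1, g x = w * ∫ t in (x ^ β)..1, g t) :
    ∀ x ∈ Icc (0 : ℝ) 1, g x = (w * ∫ t in (0 : ℝ)..1, g t) * qSeries β w x := by
  set C := w * ∫ t in (0 : ℝ)..1, g t with hC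
  obtain ⟨B, hB⟩ := isCompact_Icc.exists_bound_of_continuousOn (continuousOn_qSeries hβ w)
  -- Splitting ∫_0^1 at x^β gives g = C - w ∫_0^{x^β} g, so the difference from C times the series
  -- solves the homogeneous equation.
  have h := eq_zero_of_eq_integral hβ w (d := fun x => g x - C * qSeries β w x)
    (M := M + ‖C‖ * B) ?_ ?_
  · exact fun x hx => sub_eq_zero.1 (h x hx)
  · intro x hx
    refine (norm_sub_le _ _).trans (add_le_add (hM x hx) ?_)
    rw [norm_mul]
    exact mul_le_mul_of_nonneg_left (hB x hx) (norm_nonneg _)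
  · intro x hx
    have hy : x ^ β ∈ Icc (0 : ℝ) 1 := mapsTo_powFun (by linarith) hx
    have hsub : uIcc 0 (x ^ β) ⊆ uIcc (0 : ℝ) 1 := by
      rw [uIcc_of_le hy.1, uIcc_of_le zero_le_one]
      exact Icc_subset_Icc_right hy.2
    have hsub' : uIcc (x ^ β) 1 ⊆ uIcc (0 : ℝ) 1 := by
      rw [uIcc_of_le hy.2, uIcc_of_le zero_le_one]
      exact Icc_subset_Icc_left hy.1
    have hqi : IntervalIntegrable (qSeries β w) volume 0 (x ^ β) := by
      refine ContinuousOn.intervalIntegrable ((continuousOn_qSeries hβ w).mono ?_)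
      rwa [uIcc_of_le (zero_le_one' ℝ)] at hsub
    have hadd := intervalIntegral.integral_add_adjacent_intervals (hgi.mono_set hsub)
      (hgi.mono_set hsub')
    rw [intervalIntegral.integral_sub (hgi.mono_set hsub) (hqi.const_mul C),
      intervalIntegral.integral_const_mul, qSeries_eq hβ w hx, hg x hx]
    linear_combination w * hadd - hC

/-! ### The reflection and the adjoint -/

theorem measurePreserving_one_sub_muI : MeasurePreserving (fun x : ℝ => 1 - x) muI muI := by
  have h := (Measure.measurePreserving_sub_left (volume : Measure ℝ) 1).restrict_preimage
    (measurableSet_Ioo (a := (0 : ℝ)) (b := 1))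
  have hpre : (fun x : ℝ => 1 - x) ⁻¹' Ioo (0 : ℝ) 1 = Ioo 0 1 := by simp
  rwa [hpre] at h

/-- Composition with `x ↦ 1 - x` as a linear isometry of `L²(0,1)`. -/
noncomputable def reflIsometry : L2I →ₗᵢ[ℂ] L2I :=
  Lp.compMeasurePreservingₗᵢ ℂ (fun x : ℝ => 1 - x) measurePreserving_one_sub_muI

theorem reflIsometry_coeFn (f : L2I) : reflIsometry f =ᵐ[muI] fun x => f (1 - x) :=
  Lp.coeFn_compMeasurePreserving f measurePreserving_one_sub_muI

theorem reflIsometry_reflIsometry (f : L2I) : reflIsometry (reflIsometry f) = f := by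
  refine Lp.ext ?_
  have h := measurePreserving_one_sub_muI.quasiMeasurePreserving.ae_eq_comp (reflIsometry_coeFn f)
  filter_upwards [reflIsometry_coeFn (reflIsometry f), h] with x hx hx'
  rw [hx]
  simpa using hx'

/-- The unitary operator `(U f)(x) = f(1 - x)` on `L²(0,1)`. -/
noncomputable def reflUnitary : L2I ≃ₗᵢ[ℂ] L2I :=
  LinearIsometryEquiv.ofSurjective reflIsometry fun f =>
    ⟨reflIsometry f, reflIsometry_reflIsometry f⟩

theorem reflUnitary_coeFn (f : L2I) : reflUnitary f =ᵐ[muI] fun x => f (1 - x) :=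
  reflIsometry_coeFn f

theorem reflUnitary_symm_apply (f : L2I) : reflUnitary.symm f = reflUnitary f := by
  rw [LinearIsometryEquiv.symm_apply_eq]
  exact (reflIsometry_reflIsometry f).symm

/-- Moves the variable endpoint into the integrand, so that Fubini applies on a fixed product
measure. -/
theorem integral_zero_eq_integral_indicator (h : ℝ → ℂ) {c : ℝ} (hc : c ∈ Icc (0 : ℝ) 1) :
    ∫ t in (0 : ℝ)..c, h t = ∫ t, (Iio c).indicator h t ∂muI := by
  have hs : Iio c ∩ Ioo (0 : ℝ) 1 = Ioo 0 c := by
    ext t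
    simp only [mem_inter_iff, mem_Iio, mem_Ioo]
    exact ⟨fun h => ⟨h.2.1, h.1⟩, fun h => ⟨h.2, h.1, h.2.trans_le hc.2⟩⟩
  rw [integral_indicator measurableSet_Iio, Measure.restrict_restrict measurableSet_Iio, hs,
    intervalIntegral.integral_of_le hc.1, integral_Ioc_eq_integral_Ioo]

theorem integral_one_eq_integral_indicator (h : ℝ → ℂ) {c : ℝ} (hc : c ∈ Icc (0 : ℝ) 1) :
    ∫ t in c..1, h t = ∫ t, (Ioi c).indicator h t ∂muI := by
  have hs : Ioi c ∩ Ioo (0 : ℝ) 1 = Ioo c 1 := by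
    ext t
    simp only [mem_inter_iff, mem_Ioi, mem_Ioo]
    exact ⟨fun h => ⟨h.1, h.2.2⟩, fun h => ⟨h.1, hc.1.trans_lt h.1, h.2⟩⟩
  rw [integral_indicator measurableSet_Ioi, Measure.restrict_restrict measurableSet_Ioi, hs,
    intervalIntegral.integral_of_le hc.2, integral_Ioc_eq_integral_Ioo]

theorem integral_one_congr_muI {f g : ℝ → ℂ} (h : f =ᵐ[muI] g) {c : ℝ}
    (hc : c ∈ Icc (0 : ℝ) 1) : ∫ t in c..1, f t = ∫ t in c..1, g t := by
  rw [integral_one_eq_integral_indicator f hc, integral_one_eq_integral_indicator g hc]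
  refine integral_congr_ae ?_
  filter_upwards [h] with t ht
  by_cases hm : t ∈ Ioi c
  · rw [indicator_of_mem hm, indicator_of_mem hm, ht]
  · rw [indicator_of_notMem hm, indicator_of_notMem hm]

/-- The operator `U⁻¹ V_φ U` with `φ(x) = 1 - (1 - x)^(1/α)`. -/
noncomputable def reflConj (α : ℝ) (h0 : 0 < α) : L2I →L[ℂ] L2I :=
  (reflUnitary.symm.toContinuousLinearEquiv : L2I →L[ℂ] L2I) ∘L
    (volterraOp (fun x : ℝ => 1 - (1 - x) ^ (1 / α)) (measurable_reflPowFun α)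
      (mapsTo_reflPowFun h0)) ∘L (reflUnitary.toContinuousLinearEquiv : L2I →L[ℂ] L2I)

theorem reflConj_apply {α : ℝ} (h0 : 0 < α) (f : L2I) :
    reflConj α h0 f = reflUnitary.symm (volterraOp (fun x : ℝ => 1 - (1 - x) ^ (1 / α))
      (measurable_reflPowFun α) (mapsTo_reflPowFun h0) (reflUnitary f)) := rfl

theorem reflConj_coeFn {α : ℝ} (h0 : 0 < α) (f : L2I) :
    reflConj α h0 f =ᵐ[muI] fun x => ∫ t in (x ^ (1 / α))..1, f t := by
  rw [reflConj_apply, reflUnitary_symm_apply]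
  have h1 := measurePreserving_one_sub_muI.quasiMeasurePreserving.ae_eq_comp
    (volterraOp_coeFn _ (measurable_reflPowFun α) (mapsTo_reflPowFun h0) (reflUnitary f))
  filter_upwards [reflUnitary_coeFn (volterraOp (fun x : ℝ => 1 - (1 - x) ^ (1 / α))
    (measurable_reflPowFun α) (mapsTo_reflPowFun h0) (reflUnitary f)), h1, ae_mem_Icc_muI]
    with x hx hx1 hxI
  have hx' : (1 - x) ∈ Icc (0 : ℝ) 1 := ⟨by linarith [hxI.2], by linarith [hxI.1]⟩
  rw [hx]
  refine hx1.trans ((volterraFun_congr (mapsTo_reflPowFun h0) (reflUnitary_coeFn f) hx').trans ?_)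
  simp only [volterraFun]
  rw [intervalIntegral.integral_comp_sub_left (fun t => f t) 1]
  simp

theorem lt_rpow_iff_rpow_one_div_lt {α : ℝ} (h0 : 0 < α) {a t : ℝ} (ha : 0 ≤ a) (ht : 0 ≤ t) :
    a < t ^ α ↔ a ^ (1 / α) < t := by
  rw [one_div, Real.rpow_inv_lt_iff_of_pos ha ht h0]

/-- Both inner products are iterated integrals of y(a) times the conjugate of f(t) over the region a
< t^α, which is also t > a^(1/α); Fubini swaps the order. -/
theorem reflConj_eq_adjoint {α : ℝ} (h0 : 0 < α) :
    reflConj α h0 = ContinuousLinearMap.adjoint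
      (volterraOp (fun x : ℝ => x ^ α) (measurable_powFun α) (mapsTo_powFun h0)) := by
  rw [ContinuousLinearMap.eq_adjoint_iff]
  intro f y
  set S : Set (ℝ × ℝ) := {z | z.1 < z.2 ^ α} with hS
  have hSm : MeasurableSet S :=
    measurableSet_lt measurable_fst ((measurable_powFun α).comp measurable_snd)
  set F : ℝ → ℝ → ℂ := fun a t =>
    S.indicator (fun z => y z.1 * (starRingEnd ℂ) (f z.2)) (a, t) with hF
  have hFi : Integrable (Function.uncurry F) (muI.prod muI) := by
    have hc : Integrable (fun t => (starRingEnd ℂ) ((f : ℝ → ℂ) t)) muI :=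
      (integrable_norm_iff (Complex.continuous_conj.comp_aestronglyMeasurable
        (Lp.aestronglyMeasurable f))).1 (by simpa using (L2I_integrable f).norm)
    exact ((L2I_integrable y).mul_prod hc).indicator hSm
  rw [L2.inner_def, L2.inner_def]
  calc ∫ a, inner ℂ (reflConj α h0 f a) (y a) ∂muI
      = ∫ a, ∫ t, F a t ∂muI ∂muI := by
        refine integral_congr_ae ?_
        filter_upwards [reflConj_coeFn h0 f, ae_mem_Icc_muI] with a ha haI
        rw [ha, integral_one_eq_integral_indicator _ (mapsTo_powFun (one_div_pos.2 h0) haI),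
          RCLike.inner_apply, ← integral_conj, ← integral_const_mul]
        refine integral_congr_ae ?_
        filter_upwards [ae_mem_Icc_muI] with t htI
        have hiff : (a, t) ∈ S ↔ t ∈ Ioi (a ^ (1 / α)) :=
          lt_rpow_iff_rpow_one_div_lt h0 haI.1 htI.1
        by_cases hm : (a, t) ∈ S
        · simp only [hF]
          rw [indicator_of_mem (hiff.1 hm), indicator_of_mem hm]
        · simp only [hF]
          rw [indicator_of_notMem (mt hiff.2 hm), indicator_of_notMem hm, map_zero, mul_zero]
    _ = ∫ t, ∫ a, F a t ∂muI ∂muI := integral_integral_swap hFi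
    _ = _ := by
        refine integral_congr_ae ?_
        filter_upwards [volterraOp_coeFn _ (measurable_powFun α) (mapsTo_powFun h0) y,
          ae_mem_Icc_muI] with t ht htI
        rw [ht, integral_zero_eq_integral_indicator _ (mapsTo_powFun h0 htI),
          RCLike.inner_apply, ← integral_mul_const]
        refine integral_congr_ae (Filter.Eventually.of_forall fun a => ?_)
        by_cases hm : (a, t) ∈ S
        · simp only [hF]
          rw [indicator_of_mem (show a ∈ Iio (t ^ α) from hm), indicator_of_mem hm]
        · simp only [hF]
          rw [indicator_of_notMem (show a ∉ Iio (t ^ α) from hm), indicator_of_notMem hm, zero_mul]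

/-! ### Eigenvectors and the point spectrum -/

/-- By Lebesgue differentiation, the primitive has derivative F almost everywhere, and here it is
constant. -/
theorem eq_zero_of_forall_integral_eq_zero (F : L2I)
    (h : ∀ c ∈ Ioo (0 : ℝ) 1, ∫ t in c..1, F t = 0) : F = 0 := by
  have hi := L2I_intervalIntegrable F (y := 1) ⟨zero_le_one, le_rfl⟩
  refine Lp.ext ?_
  filter_upwards [ae_restrict_of_ae hi.ae_hasDerivAt_integral, ae_restrict_mem measurableSet_Ioo,
    Lp.coeFn_zero ℂ 2 muI] with x hx hxI h0
  rw [h0]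
  have hd := hx (by rw [uIcc_of_le zero_le_one]; exact Ioo_subset_Icc_self hxI) 1 right_mem_uIcc
  have hz : HasDerivAt (fun y => ∫ t in (1 : ℝ)..y, F t) 0 x := by
    refine (hasDerivAt_const x (0 : ℂ)).congr_of_eventuallyEq ?_
    filter_upwards [isOpen_Ioo.mem_nhds hxI] with y hy
    rw [intervalIntegral.integral_symm, h y hy, neg_zero]
  exact hd.unique hz

/-- Excludes the eigenvalue 0. Continuity of the primitive upgrades almost everywhere to everywhere
on (0,1), and x = c^α reaches every lower limit c. -/
theorem reflConj_injective {α : ℝ} (h0 : 0 < α) (F : L2I) (hF : reflConj α h0 F = 0) : F = 0 := by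
  have hβ : 0 < 1 / α := one_div_pos.2 h0
  have hi := L2I_intervalIntegrable F (y := 1) ⟨zero_le_one, le_rfl⟩
  have hcont : ContinuousOn (fun x : ℝ => ∫ t in (x ^ (1 / α))..1, F t) (Ioo 0 1) := by
    have h1 := (intervalIntegral.continuousOn_primitive_interval' hi right_mem_uIcc).neg
    rw [uIcc_of_le zero_le_one] at h1
    refine (h1.comp (Real.continuous_rpow_const hβ.le).continuousOn
      ((mapsTo_powFun hβ).mono_left Ioo_subset_Icc_self)).congr fun x _ => ?_
    exact intervalIntegral.integral_symm _ _
  have hae : (fun x : ℝ => ∫ t in (x ^ (1 / α))..1, F t) =ᵐ[muI] fun _ => (0 : ℂ) := by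
    have h1 := reflConj_coeFn h0 F
    rw [hF] at h1
    exact h1.symm.trans (Lp.coeFn_zero ℂ 2 muI)
  have hz := Measure.eqOn_open_of_ae_eq hae isOpen_Ioo hcont continuousOn_const
  refine eq_zero_of_forall_integral_eq_zero F fun c hc => ?_
  have h2 := hz (x := c ^ α) ⟨Real.rpow_pos_of_pos hc.1 _, Real.rpow_lt_one hc.1.le hc.2 h0⟩
  simp only at h2
  rwa [← Real.rpow_mul hc.1.le, mul_one_div_cancel h0.ne', Real.rpow_one] at h2

theorem qExp_eq_zero_of_eigenvector {α : ℝ} (h0 : 0 < α) (h1 : α < 1) {μ : ℂ} (hμ : μ ≠ 0)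
    {F : L2I} (hF : F ≠ 0) (h : reflConj α h0 F = μ • F) : qExp (1 / α) μ⁻¹ = 0 := by
  have hβ : 1 ≤ 1 / α := (one_le_div h0).2 h1.le
  have hmaps := mapsTo_powFun (one_div_pos.2 h0)
  -- The right side of the eigenvalue equation is a bounded representative of F defined at every
  -- point, so its value 0 at x = 1 makes sense.
  set g : ℝ → ℂ := fun x => μ⁻¹ * ∫ t in (x ^ (1 / α))..1, F t with hg
  have hFg : F =ᵐ[muI] g := by
    have hc := reflConj_coeFn h0 F
    rw [h] at hc
    filter_upwards [hc, Lp.coeFn_smul μ F] with x hx hx'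
    simp only [hg, ← hx, hx', Pi.smul_apply, smul_eq_mul]
    rw [inv_mul_cancel_left₀ hμ]
  have hM : ∀ x ∈ Icc (0 : ℝ) 1, ‖g x‖ ≤ ‖μ⁻¹‖ * ∫ t, ‖F t‖ ∂muI := by
    intro x hx
    simp only [hg]
    rw [norm_mul, integral_one_eq_integral_indicator _ (hmaps hx)]
    refine mul_le_mul_of_nonneg_left ?_ (norm_nonneg _)
    exact norm_integral_le_of_norm_le (L2I_integrable F).norm
      (Filter.Eventually.of_forall fun t => norm_indicator_le_norm_self _ _)
  have hgi : IntervalIntegrable g volume 0 1 := by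
    rw [intervalIntegrable_iff_integrableOn_Ioc_of_le zero_le_one, IntegrableOn,
      restrict_Ioc_eq_muI]
    exact (L2I_integrable F).congr hFg
  have hge : ∀ x ∈ Icc (0 : ℝ) 1, g x = μ⁻¹ * ∫ t in (x ^ (1 / α))..1, g t := fun x hx => by
    rw [← integral_one_congr_muI hFg (hmaps hx)]
  have hsol := eq_smul_qSeries hβ μ⁻¹ hM hgi hge
  have h1' := hsol 1 ⟨zero_le_one, le_rfl⟩
  have hg1 : g 1 = 0 := by simp [hg]
  rw [hg1, qSeries_one] at h1'
  refine (mul_eq_zero.1 h1'.symm).resolve_left fun hC => hF (Lp.ext ?_)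
  filter_upwards [hFg, ae_mem_Icc_muI, Lp.coeFn_zero ℂ 2 muI] with x hx hxI hx0
  rw [hx, hsol x hxI, hC, zero_mul, hx0, Pi.zero_apply]

theorem exists_eigenvector_of_qExp_eq_zero {α : ℝ} (h0 : 0 < α) (h1 : α < 1) {μ : ℂ} (hμ : μ ≠ 0)
    (h : qExp (1 / α) μ⁻¹ = 0) : ∃ F : L2I, F ≠ 0 ∧ reflConj α h0 F = μ • F := by
  have hβ : 1 ≤ 1 / α := (one_le_div h0).2 h1.le
  have hmaps := mapsTo_powFun (one_div_pos.2 h0)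
  set g := qSeries (1 / α) μ⁻¹ with hg
  have hcont : ContinuousOn g (Icc 0 1) := continuousOn_qSeries hβ μ⁻¹
  obtain ⟨B, hB⟩ := isCompact_Icc.exists_bound_of_continuousOn hcont
  have hmem : MemLp g 2 muI :=
    MemLp.of_bound ((hcont.mono Ioo_subset_Icc_self).aestronglyMeasurable measurableSet_Ioo) B
      (ae_mem_Icc_muI.mono hB)
  -- The zero of the q-exponential is the boundary condition g(1) = 0; it turns 1 - w ∫_0^{x^β} g
  -- into w ∫_{x^β}^1 g and also shows that g is not null.
  have hone : 1 = μ⁻¹ * ∫ t in (0 : ℝ)..1, g t := by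
    have h2 := qSeries_eq hβ μ⁻¹ (x := 1) ⟨zero_le_one, le_rfl⟩
    rw [qSeries_one, h, Real.one_rpow] at h2
    exact (sub_eq_zero.1 h2.symm)
  refine ⟨hmem.toLp g, fun hz => ?_, Lp.ext ?_⟩
  · have hg0 : g =ᵐ[muI] fun _ => (0 : ℂ) := by
      have h2 := hmem.coeFn_toLp
      rw [hz] at h2
      exact h2.symm.trans (Lp.coeFn_zero ℂ 2 muI)
    rw [integral_one_congr_muI hg0 ⟨le_rfl, zero_le_one⟩] at hone
    simp at hone
  · filter_upwards [reflConj_coeFn h0 (hmem.toLp g), Lp.coeFn_smul μ (hmem.toLp g),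
      hmem.coeFn_toLp, ae_mem_Icc_muI] with x hx hx1 hx2 hxI
    have hy := hmaps hxI
    rw [hx, hx1, Pi.smul_apply, hx2, smul_eq_mul, integral_one_congr_muI hmem.coeFn_toLp hy]
    have hint : ∀ a ∈ Icc (0 : ℝ) 1, ∀ b ∈ Icc (0 : ℝ) 1, IntervalIntegrable g volume a b :=
      fun a ha b hb => (hcont.mono (ordConnected_Icc.uIcc_subset ha hb)).intervalIntegrable
    have hadd := intervalIntegral.integral_add_adjacent_intervals
      (hint 0 ⟨le_rfl, zero_le_one⟩ _ hy) (hint _ hy 1 ⟨zero_le_one, le_rfl⟩)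
    have hgx : g x = μ⁻¹ * ∫ t in (x ^ (1 / α))..1, g t := by
      rw [hg, qSeries_eq hβ μ⁻¹ hxI, ← hg]
      linear_combination hone - μ⁻¹ * hadd
    rw [hgx, mul_inv_cancel_left₀ hμ]

theorem mem_pointSpectrum_iff (T : L2I →L[ℂ] L2I) (μ : ℂ) :
    μ ∈ pointSpectrum T ↔ ∃ f : L2I, f ≠ 0 ∧ T f = μ • f := by
  constructor
  · intro h
    obtain ⟨f, hf⟩ := Module.End.HasEigenvalue.exists_hasEigenvector h
    exact ⟨f, hf.2, hf.apply_eq_smul⟩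
  · rintro ⟨f, hf, h⟩
    exact Module.End.hasEigenvalue_of_hasEigenvector
      (Module.End.hasEigenvector_iff.2 ⟨Module.End.mem_eigenspace_iff.2 h, hf⟩)

theorem pointSpectrum_reflConj {α : ℝ} (h0 : 0 < α) :
    pointSpectrum (reflConj α h0) =
      pointSpectrum (volterraOp (fun x : ℝ => 1 - (1 - x) ^ (1 / α)) (measurable_reflPowFun α)
        (mapsTo_reflPowFun h0)) := by
  ext μ
  simp only [mem_pointSpectrum_iff, reflConj_apply, LinearIsometryEquiv.symm_apply_eq, map_smul]
  constructor
  · rintro ⟨f, hf, h⟩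
    exact ⟨reflUnitary f, by simpa using hf, h⟩
  · rintro ⟨f, hf, h⟩
    exact ⟨reflUnitary.symm f, by simpa using hf, by simpa using h⟩

theorem mem_pointSpectrum_reflConj_iff {α : ℝ} (h0 : 0 < α) (h1 : α < 1) (μ : ℂ) :
    μ ∈ pointSpectrum (reflConj α h0) ↔ ∃ n : ℕ, μ = (1 - (α : ℂ)) * (α : ℂ) ^ n := by
  have hαC : (α : ℂ) ≠ 0 := by exact_mod_cast h0.ne'
  have hαC' : (1 - (α : ℂ)) ≠ 0 := sub_ne_zero.2 (by exact_mod_cast h1.ne')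
  rw [mem_pointSpectrum_iff]
  constructor
  · rintro ⟨F, hF, h⟩
    have hμ : μ ≠ 0 := by
      rintro rfl
      exact hF (reflConj_injective h0 F (by rw [h, zero_smul]))
    have hq := qExp_eq_zero_of_eigenvector h0 h1 hμ hF h
    rw [one_div, qExp_eq_zero_iff h0 h1] at hq
    obtain ⟨n, hn⟩ := hq
    exact ⟨n, ((inv_mul_eq_one₀ hμ).1 hn)⟩
  · rintro ⟨n, rfl⟩
    have hμ := mul_ne_zero hαC' (pow_ne_zero n hαC)
    refine exists_eigenvector_of_qExp_eq_zero h0 h1 hμ ?_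
    rw [one_div, qExp_eq_zero_iff h0 h1]
    exact ⟨n, inv_mul_cancel₀ hμ⟩

theorem corollary1 (α : ℝ) (h0 : 0 < α) (h1 : α < 1) :
    (∃ U : L2I ≃ₗᵢ[ℂ] L2I,
      (∀ f : L2I, U f =ᵐ[muI] fun x => f (1 - x)) ∧
      ∀ f : L2I,
        ContinuousLinearMap.adjoint
            (volterraOp (fun x : ℝ => x ^ α) (measurable_powFun α) (mapsTo_powFun h0)) f =
          U.symm
            (volterraOp (fun x : ℝ => 1 - (1 - x) ^ (1 / α)) (measurable_reflPowFun α)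
              (mapsTo_reflPowFun h0) (U f))) ∧
    pointSpectrum
        (volterraOp (fun x : ℝ => 1 - (1 - x) ^ (1 / α)) (measurable_reflPowFun α)
          (mapsTo_reflPowFun h0)) =
      {μ : ℂ | ∃ n : ℕ, 1 ≤ n ∧ μ = (1 - (α : ℂ)) * (α : ℂ) ^ (n - 1)} := by
  refine ⟨⟨reflUnitary, reflUnitary_coeFn, fun f => ?_⟩, ?_⟩
  · rw [← reflConj_eq_adjoint h0, reflConj_apply]
  · rw [← pointSpectrum_reflConj h0]
    ext μ
    rw [mem_pointSpectrum_reflConj_iff h0 h1, mem_ofPred_eq]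
    constructor
    · rintro ⟨n, hn⟩
      exact ⟨n + 1, by omega, by simpa using hn⟩
    · rintro ⟨n, _, hn⟩
      exact ⟨n - 1, hn⟩
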